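/- Let $k$ be a field of characteristic different from $2$, let $$G_3^2=\langle a,b,c \mid a^2=b^2=c^2=1,\ bca=acb\rangle ,$$ and let $kG_3^2$ be its group algebra over $k$. For a $k$-algebra $\Lambda$ and a $\Lambda$-bimodule $W$ (on which the left and right actions of $k$ coincide), let $H^n(\Lambda,W)=\operatorname{Ker}\Delta_n/\operatorname{Im}\Delta_{n-1}$, $n\ge 1$, be the Hochschild cohomology, where $\Delta_n:\operatorname{Hom}_k(\Lambda^{\otimes n},W)\to\operatorname{Hom}_k(\Lambda^{\otimes (n+1)},W)$ is given by $$(\Delta_n f)(r_1,\dots,r_{n+1})=r_1f(r_2,\dots,r_{n+1})+\sum_{i=1}^{n}(-1)^if(r_1,\dots,r_ir_{i+1},\dots,r_{n+1})+(-1)^{n+1}f(r_1,\dots,r_n)r_{n+1}.$$ Then for every $kG_3^2$-bimodule $W$ with $\dim_k W=1$ and every $n\ge 3$, $$H^n(kG_3^2,W)=0 .$$ -/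

import Mathlib

/-- The three generators `a`, `b`, `c`. -/
inductive G23Gen : Type
  | a
  | b
  | c

/-- The defining relators of `G^2_3`: `a² = b² = c² = 1` and `bca = acb`. -/
def G23Rels : Set (FreeGroup G23Gen) :=
  {FreeGroup.of .a ^ 2, FreeGroup.of .b ^ 2, FreeGroup.of .c ^ 2,
    (FreeGroup.of .b * FreeGroup.of .c * FreeGroup.of .a) *
      (FreeGroup.of .a * FreeGroup.of .c * FreeGroup.of .b)⁻¹}

/-- The group `G^2_3 = ⟨a, b, c ∣ a² = b² = c² = 1, bca = acb⟩`. -/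
abbrev G23 : Type := PresentedGroup G23Rels

namespace Hochschild

section contract

variable {n : ℕ} {A : Type*}

theorem tail_update_zero (g : Fin (n + 1) → A) (x : A) :
    (fun i : Fin n => Function.update g 0 x i.succ) = fun i => g i.succ := by
  funext i
  simp [Function.update_of_ne]

theorem tail_update_succ (g : Fin (n + 1) → A) (j : Fin n) (x : A) :
    (fun i : Fin n => Function.update g j.succ x i.succ)
      = Function.update (fun i => g i.succ) j x := by
  funext i
  by_cases h : i = j
  · subst h; simp
  · simp [h]

theorem init_update_last (g : Fin (n + 1) → A) (x : A) :
    (fun i : Fin n => Function.update g (Fin.last n) x i.castSucc) = fun i => g i.castSucc := by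
  funext i
  simp [Function.update_of_ne]

theorem init_update_castSucc (g : Fin (n + 1) → A) (j : Fin n) (x : A) :
    (fun i : Fin n => Function.update g j.castSucc x i.castSucc)
      = Function.update (fun i => g i.castSucc) j x := by
  funext i
  by_cases h : i = j
  · subst h; simp
  · simp [h]

/-- `(r₀, …, rₙ) ↦ (r₀, …, rᵢ rᵢ₊₁, …, rₙ)`, the indices running from `0`. -/
def contract [Mul A] (i : Fin n) (g : Fin (n + 1) → A) : Fin n → A := fun l =>
  if l < i then g l.castSucc
  else if l = i then g i.castSucc * g i.succ
  else g l.succ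

theorem contract_update (k : Type*) [CommRing k] [Ring A] [Algebra k A]
    (i : Fin n) (g : Fin (n + 1) → A) (j : Fin (n + 1)) :
    ∃ (l : Fin n) (L : A →ₗ[k] A), ∀ x,
      contract i (Function.update g j x) = Function.update (contract i g) l (L x) := by
  rcases lt_trichotomy (j : ℕ) (i : ℕ) with h | h | h
  · refine ⟨⟨j, by omega⟩, LinearMap.id, fun x => ?_⟩
    funext m
    simp only [contract, Function.update_apply, Fin.lt_def, Fin.ext_iff, Fin.val_castSucc,
      Fin.val_succ, LinearMap.id_apply]
    split_ifs <;> first | rfl | omega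
  · refine ⟨i, LinearMap.mulRight k (g i.succ), fun x => ?_⟩
    funext m
    simp only [contract, Function.update_apply, Fin.lt_def, Fin.ext_iff, Fin.val_castSucc,
      Fin.val_succ, LinearMap.mulRight_apply]
    split_ifs <;> first | rfl | omega
  · by_cases h' : (j : ℕ) = i + 1
    · refine ⟨i, LinearMap.mulLeft k (g i.castSucc), fun x => ?_⟩
      funext m
      simp only [contract, Function.update_apply, Fin.lt_def, Fin.ext_iff, Fin.val_castSucc,
        Fin.val_succ, LinearMap.mulLeft_apply]
      split_ifs <;> first | rfl | omega
    · refine ⟨⟨j - 1, by omega⟩, LinearMap.id, fun x => ?_⟩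
      funext m
      simp only [contract, Function.update_apply, Fin.lt_def, Fin.ext_iff, Fin.val_castSucc,
        Fin.val_succ, LinearMap.id_apply]
      split_ifs <;> first | rfl | omega

end contract

section complex

variable (k Λ W : Type*) [CommRing k] [Ring Λ] [Algebra k Λ] [AddCommGroup W] [Module k W]
  [Module Λ W] [Module Λᵐᵒᵖ W] [IsScalarTower k Λ W] [IsScalarTower k Λᵐᵒᵖ W]

/-- The Hochschild `n`-cochains `Hom_k(Λ^{⊗ n}, W)`, as `k`-multilinear maps `Λⁿ → W`. -/
abbrev Cochain (n : ℕ) : Type _ := MultilinearMap k (fun _ : Fin n => Λ) W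

variable {k Λ W}

/-- The term `r₀ f(r₁, …, rₙ)`. -/
def dLeft {n : ℕ} (f : Cochain k Λ W n) : Cochain k Λ W (n + 1) :=
  MultilinearMap.mk' (fun g => g 0 • f fun i => g i.succ)
    (fun g j x y => by
      refine Fin.cases ?_ (fun j => ?_) j
      · simp only [tail_update_zero, Function.update_self, add_smul]
      · simp only [tail_update_succ, MultilinearMap.map_update_add, smul_add,
          Function.update_of_ne (Fin.succ_ne_zero j).symm])
    (fun g j c x => by
      refine Fin.cases ?_ (fun j => ?_) j
      · simp only [tail_update_zero, Function.update_self, smul_assoc]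
      · simp only [tail_update_succ, MultilinearMap.map_update_smul,
          Function.update_of_ne (Fin.succ_ne_zero j).symm]
        exact smul_comm _ _ _)

/-- The term `f(r₀, …, rᵢ rᵢ₊₁, …, rₙ)`. -/
def dMid {n : ℕ} (i : Fin n) (f : Cochain k Λ W n) : Cochain k Λ W (n + 1) :=
  MultilinearMap.mk' (fun g => f (contract i g))
    (fun g j x y => by
      obtain ⟨l, L, h⟩ := contract_update k i g j
      simp only [h, map_add, MultilinearMap.map_update_add])
    (fun g j c x => by
      obtain ⟨l, L, h⟩ := contract_update k i g j
      simp only [h, map_smul, MultilinearMap.map_update_smul])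

/-- The term `f(r₀, …, rₙ₋₁) rₙ`. -/
def dRight {n : ℕ} (f : Cochain k Λ W n) : Cochain k Λ W (n + 1) :=
  MultilinearMap.mk' (fun g => MulOpposite.op (g (Fin.last n)) • f fun i => g i.castSucc)
    (fun g j x y => by
      refine Fin.lastCases ?_ (fun j => ?_) j
      · simp only [init_update_last, Function.update_self, MulOpposite.op_add, add_smul]
      · simp only [init_update_castSucc, MultilinearMap.map_update_add, smul_add,
          Function.update_of_ne (Fin.castSucc_lt_last j).ne'])
    (fun g j c x => by
      refine Fin.lastCases ?_ (fun j => ?_) j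
      · simp only [init_update_last, Function.update_self, MulOpposite.op_smul, smul_assoc]
      · simp only [init_update_castSucc, MultilinearMap.map_update_smul,
          Function.update_of_ne (Fin.castSucc_lt_last j).ne']
        exact smul_comm _ _ _)

variable (k Λ W)

/-- The Hochschild differential
`(Δₙ f)(r₁, …, rₙ₊₁) = r₁ f(r₂, …, rₙ₊₁) + ∑_{i=1}^{n} (-1)^i f(r₁, …, rᵢ rᵢ₊₁, …, rₙ₊₁)
  + (-1)^{n+1} f(r₁, …, rₙ) rₙ₊₁`. -/
def differential (n : ℕ) : Cochain k Λ W n →ₗ[k] Cochain k Λ W (n + 1) where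
  toFun f := dLeft f + ∑ i : Fin n, (-1 : k) ^ ((i : ℕ) + 1) • dMid i f
    + (-1 : k) ^ (n + 1) • dRight f
  map_add' f f' := by
    ext g
    simp [dLeft, dMid, dRight, Finset.sum_add_distrib]
    abel
  map_smul' c f := by
    ext g
    simp [dLeft, dMid, dRight, Finset.smul_sum, smul_comm _ c]

/-- The Hochschild `n`-cocycles `Ker Δₙ`. -/
def cocycles (n : ℕ) : Submodule k (Cochain k Λ W n) :=
  LinearMap.ker (differential k Λ W n)

/-- The Hochschild `n`-coboundaries: `0` for `n = 0`, and `Im Δₙ₋₁` for `n ≥ 1`. -/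
def coboundaries : (n : ℕ) → Submodule k (Cochain k Λ W n)
  | 0 => ⊥
  | n + 1 => LinearMap.range (differential k Λ W n)

/-- The Hochschild cohomology `Hⁿ(Λ, W) = Ker Δₙ / Im Δₙ₋₁`. -/
abbrev Cohomology (n : ℕ) : Type _ :=
  cocycles k Λ W n ⧸ (coboundaries k Λ W n).submoduleOf (cocycles k Λ W n)

end complex

end Hochschild

/-! For a group `G`, the Hochschild complex of `kG` with values in `W` is the complex of
`G`-invariant homogeneous cochains with values in `W` under conjugation `w ↦ g w g⁻¹` (`toHomog`,
`subsingleton_cohomology`), so the claim is one about group cohomology.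

In `G^2_3` put `t = ca` and `s = cb`. The relation `bca = acb` says that `s` and `t` commute, and
conjugation by `c` inverts both. The group acts on `ℤ²` by half-turns with `t`, `s` as the two unit
translations, so it is `ℤ²` extended by an involution. The subgroup `ℤ²` has no cohomology in
degrees `≥ 3`, and the involution is handled by averaging, as `2` is invertible.

The vanishing for `ℤ²` is proved by hand. The complex of all homogeneous cochains is exact
(`exists_d_eq`), and `t - 1` is surjective on it in at least one variable (`act_divide_sub`), since
an integer coordinate on `G` that `t` translates allows summation along `t`-orbits. Any primitive of
an invariant cocycle can then be corrected to an invariant one, at the cost of one degree for each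
of `t` and `s`. -/

/-- Homogeneous cochains in `m` variables: arbitrary functions `Gᵐ → W`. -/
abbrev HomogCochain (G W : Type*) (m : ℕ) : Type _ := (Fin m → G) → W

namespace HomogCochain

/-! ### Exactness of the augmented complex of homogeneous cochains. -/

section cone

variable {G W : Type*} {m : ℕ}

/-- Plugging `p` into the first variable. -/
def cone (p : G) (F : HomogCochain G W (m + 1)) : HomogCochain G W m :=
  fun x => F (Fin.cons p x)

theorem ext_cone {F F' : HomogCochain G W (m + 1)} (h : ∀ p, cone p F = cone p F') : F = F' := by
  ext x
  have := congrFun (h (x 0)) (Fin.tail x)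
  simpa [cone] using this

end cone

section complex

variable {G W : Type*} [AddCommGroup W] {m : ℕ}

/-- The simplicial coboundary `(dF)(x₀, …, xₘ) = ∑ᵢ (-1)ⁱ F(x₀, …, x̂ᵢ, …, xₘ)`. -/
def d (F : HomogCochain G W m) : HomogCochain G W (m + 1) :=
  fun x => ∑ i : Fin (m + 1), (-1 : ℤ) ^ (i : ℕ) • F fun j => x (i.succAbove j)

theorem d_add (F F' : HomogCochain G W m) : d (F + F') = d F + d F' := by
  ext x
  simp [d, Finset.sum_add_distrib]

theorem d_sub (F F' : HomogCochain G W m) : d (F - F') = d F - d F' := by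
  ext x
  simp [d, smul_sub]

theorem d_smul {k : Type*} [Semiring k] [Module k W] (c : k) (F : HomogCochain G W m) :
    d (c • F) = c • d F := by
  ext x
  simp only [d, Pi.smul_apply, Finset.smul_sum, smul_comm c]

theorem cone_d_zero (p : G) (F : HomogCochain G W 0) : cone p (d F) = F := by
  ext x
  simp only [cone, d, Nat.reduceAdd, Fin.sum_univ_one, Fin.val_zero, pow_zero, one_smul]
  congr 1

/-- Omitting the vertex `p` returns `F`; omitting a later vertex commutes with the cone, with the
sign shifted by one. Thus `cone p` is a contracting homotopy. -/
theorem cone_d_succ (p : G) (F : HomogCochain G W (m + 1)) :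
    cone p (d F) = F - d (cone p F) := by
  ext x
  simp only [cone, d, Pi.sub_apply]
  rw [Fin.sum_univ_succ, sub_eq_add_neg, ← Finset.sum_neg_distrib]
  congr 1
  · simp
  · refine Finset.sum_congr rfl fun i _ => ?_
    rw [Fin.val_succ, pow_succ, mul_neg_one, neg_smul]
    congr 3
    funext j
    refine Fin.cases ?_ (fun j => ?_) j <;> simp

/-- The homotopy formula, applied twice, turns `cone p (d (d F))` into `d (d (cone p F))`, which has
one variable fewer: induction replaces the usual double sum. -/
theorem d_d : ∀ {m : ℕ} (F : HomogCochain G W m), d (d F) = 0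
  | 0, F => by
    refine ext_cone fun p => ?_
    rw [cone_d_succ, cone_d_zero, sub_self]
    rfl
  | m + 1, F => by
    refine ext_cone fun p => ?_
    rw [cone_d_succ, cone_d_succ, d_sub, d_d (cone p F), sub_zero, sub_self]
    rfl

theorem exists_d_eq [Nonempty G] (F : HomogCochain G W (m + 1)) (hF : d F = 0) :
    ∃ E : HomogCochain G W m, d E = F := by
  obtain ⟨p⟩ := ‹Nonempty G›
  refine ⟨cone p F, ?_⟩
  have h := cone_d_succ p F
  rw [hF] at h
  exact (sub_eq_zero.1 h.symm).symm

end complex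

/-! ### The diagonal group action on homogeneous cochains. -/

section action

variable {k G W : Type*} [CommRing k] [Group G] [AddCommGroup W] [Module k W]
  (ρ : Representation k G W) {m : ℕ}

/-- The diagonal action `(g F)(x) = g (F (g⁻¹ x))` of `G` on homogeneous cochains. -/
def act (g : G) (F : HomogCochain G W m) : HomogCochain G W m :=
  fun x => ρ g (F fun i => g⁻¹ * x i)

theorem act_one (F : HomogCochain G W m) : act ρ 1 F = F := by
  ext x
  simp [act]

theorem act_mul (g h : G) (F : HomogCochain G W m) : act ρ (g * h) F = act ρ g (act ρ h F) := by
  ext x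
  simp [act, mul_assoc]

theorem act_add (g : G) (F F' : HomogCochain G W m) :
    act ρ g (F + F') = act ρ g F + act ρ g F' := by
  ext x
  simp [act]

theorem act_sub (g : G) (F F' : HomogCochain G W m) :
    act ρ g (F - F') = act ρ g F - act ρ g F' := by
  ext x
  simp [act]

theorem act_smul (g : G) (c : k) (F : HomogCochain G W m) : act ρ g (c • F) = c • act ρ g F := by
  ext x
  simp [act]

theorem act_d (g : G) (F : HomogCochain G W m) : act ρ g (d F) = d (act ρ g F) := by
  ext x
  simp [act, d, map_sum]

/-- The elements of `G` that fix a given homogeneous cochain. -/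
def fixer (F : HomogCochain G W m) : Subgroup G where
  carrier := {g | act ρ g F = F}
  one_mem' := act_one ρ F
  mul_mem' {g h} hg hh := by
    simp only [Set.mem_ofPred_eq] at hg hh ⊢
    rw [act_mul, hh, hg]
  inv_mem' {g} hg := by
    simp only [Set.mem_ofPred_eq] at hg ⊢
    conv_lhs => rw [← hg]
    rw [← act_mul, inv_mul_cancel, act_one]

end action

/-! ### Solving `t E - E = F` by summation along `t`-orbits. -/

section primitive

variable {W : Type*} [AddCommGroup W]

/-- The primitive on `ℤ`, vanishing at `0`, of a `W`-valued function. -/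
def intPrimitive (u : ℤ → W) : ℤ → W
  | .ofNat n => ∑ l ∈ Finset.range n, u (l + 1)
  | .negSucc n => -∑ l ∈ Finset.range (n + 1), u (-l)

theorem intPrimitive_sub (u : ℤ → W) (i : ℤ) :
    intPrimitive u i - intPrimitive u (i - 1) = u i := by
  rcases i with (_ | n) | n
  · change intPrimitive u 0 - intPrimitive u (Int.negSucc 0) = u 0
    change (∑ l ∈ Finset.range 0, u (l + 1)) - -∑ l ∈ Finset.range 1, u (-l) = u 0
    simp
  · have h : (Int.ofNat (n + 1) - 1 : ℤ) = Int.ofNat n := by simp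
    rw [h]
    simp [intPrimitive, Finset.sum_range_succ]
  · have h : (Int.negSucc n - 1 : ℤ) = Int.negSucc (n + 1) := by omega
    have h' : (Int.negSucc n : ℤ) = -((n : ℤ) + 1) := by omega
    rw [h]
    simp only [intPrimitive]
    rw [Finset.sum_range_succ _ (n + 1), h']
    push_cast
    abel

theorem map_intPrimitive (φ : W →+ W) (u : ℤ → W) (i : ℤ) :
    φ (intPrimitive u i) = intPrimitive (fun l => φ (u l)) i := by
  rcases i with n | n <;> simp [intPrimitive, map_sum]

end primitive

section divide

variable {k G W : Type*} [CommRing k] [Group G] [AddCommGroup W] [Module k W]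
  (ρ : Representation k G W) {m : ℕ}

/-- A solution `E` of `t E - E = F`, constructed from a function `c : G → ℤ` with
`c (t x) = c x + 1`. -/
def divide (t : G) (c : G → ℤ) (F : HomogCochain G W (m + 1)) : HomogCochain G W (m + 1) :=
  fun x => -ρ (t ^ c (x 0)) (intPrimitive
    (fun l => ρ (t ^ (-l)) (F fun j => t ^ (l - c (x 0)) * x j)) (c (x 0)))

/-- The function of `l` summed in `divide` is the same for `x` and `t⁻¹ x`, while the endpoint drops
from `c (x 0)` to `c (x 0) - 1`. The difference is therefore the single summand at `l = c (x 0)`,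
which is `F x` after applying `t ^ c (x 0)`. -/
theorem act_divide_sub {t : G} {c : G → ℤ} (hc : ∀ x, c (t * x) = c x + 1)
    (F : HomogCochain G W (m + 1)) : act ρ t (divide ρ t c F) - divide ρ t c F = F := by
  ext x
  have hc' : c (t⁻¹ * x 0) = c (x 0) - 1 := by
    have := hc (t⁻¹ * x 0)
    rw [mul_inv_cancel_left] at this
    omega
  have hu : (fun l : ℤ => ρ (t ^ (-l)) (F fun j => t ^ (l - (c (x 0) - 1)) * (t⁻¹ * x j)))
      = fun l => ρ (t ^ (-l)) (F fun j => t ^ (l - c (x 0)) * x j) := by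
    funext l
    congr 2
    funext j
    rw [← mul_assoc, ← zpow_sub_one]
    congr 2
    ring
  simp only [Pi.sub_apply, act, divide, hc', hu, map_neg]
  rw [← Module.End.mul_apply, ← map_mul, ← zpow_one_add, add_sub_cancel, neg_sub_neg,
    ← map_sub, intPrimitive_sub, ← Module.End.mul_apply, ← map_mul, ← zpow_add]
  simp

/-- The construction involves only `F`, powers of `t` and the coordinate `c`, all of which are
compatible with `s`. This keeps invariance under one translation while dividing by the other. -/
theorem act_divide_eq {s t : G} {c : G → ℤ} (hst : Commute s t) (hc : ∀ x, c (s * x) = c x)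
    {F : HomogCochain G W (m + 1)} (hF : act ρ s F = F) :
    act ρ s (divide ρ t c F) = divide ρ t c F := by
  ext x
  have hc' : c (s⁻¹ * x 0) = c (x 0) := by
    rw [← hc, mul_inv_cancel_left]
  simp only [act, divide, hc', map_neg]
  rw [← Module.End.mul_apply, ← map_mul, (hst.zpow_right _).eq, map_mul, Module.End.mul_apply]
  congr 2
  refine (map_intPrimitive (ρ s).toAddMonoidHom _ _).trans ?_
  congr 1
  funext l
  simp only [LinearMap.toAddMonoidHom_coe]
  rw [← Module.End.mul_apply, ← map_mul, (hst.zpow_right _).eq, map_mul, Module.End.mul_apply]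
  conv_rhs => rw [← hF]
  simp only [act]
  congr 3
  funext j
  rw [← mul_assoc, ← mul_assoc, (hst.inv_left.zpow_right _).eq]

end divide

/-! ### Vanishing for `ℤ`, then `ℤ²`, then `ℤ²` with an involution. -/

section vanishing

variable {k G W : Type*} [CommRing k] [Group G] [AddCommGroup W] [Module k W]
  (ρ : Representation k G W) {m : ℕ}

/-- `H^n(⟨t⟩, W) = 0` for `n ≥ 2`, if `t` translates an integer coordinate on `G`. -/
theorem exists_d_eq_of_act_eq {t : G} {c : G → ℤ} (hc : ∀ x, c (t * x) = c x + 1)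
    (F : HomogCochain G W (m + 3)) (hF : d F = 0) (ht : act ρ t F = F) :
    ∃ E : HomogCochain G W (m + 2), act ρ t E = E ∧ d E = F := by
  obtain ⟨E, rfl⟩ := exists_d_eq F hF
  -- The failure of `E` to be invariant is a coboundary `d E'`. Writing `E' = t D - D`, the
  -- correction by `d D` cancels it without changing `d E`. The division needs a variable to read
  -- the coordinate from, hence the `m + 3`.
  obtain ⟨E', hE'⟩ := exists_d_eq (act ρ t E - E) (by rw [d_sub, ← act_d, ht, sub_self])
  refine ⟨E - d (divide ρ t c E'), ?_, by rw [d_sub, d_d, sub_zero]⟩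
  rw [← sub_eq_zero, act_sub, act_d, sub_sub_sub_comm, ← d_sub, act_divide_sub ρ hc, hE', sub_self]

/-- `H^n(⟨s, t⟩, W) = 0` for `n ≥ 3`, if the commuting elements `s`, `t` translate two integer
coordinates on `G` independently. -/
theorem exists_d_eq_of_act_eq_of_act_eq {s t : G} (hst : Commute s t) {c e : G → ℤ}
    (hct : ∀ x, c (t * x) = c x + 1) (hes : ∀ x, e (s * x) = e x + 1)
    (het : ∀ x, e (t * x) = e x)
    (F : HomogCochain G W (m + 4)) (hF : d F = 0) (ht : act ρ t F = F) (hs : act ρ s F = F) :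
    ∃ E : HomogCochain G W (m + 3), act ρ t E = E ∧ act ρ s E = E ∧ d E = F := by
  obtain ⟨E, htE, rfl⟩ := exists_d_eq_of_act_eq ρ hct F hF ht
  -- Same correction for `s`, performed inside the `t`-invariant cochains, where the previous lemma
  -- supplies exactness.
  obtain ⟨E', htE', hE'⟩ := exists_d_eq_of_act_eq ρ hct (act ρ s E - E)
    (by rw [d_sub, ← act_d, hs, sub_self])
    (by rw [act_sub, ← act_mul, ← hst.eq, act_mul, htE])
  refine ⟨E - d (divide ρ s e E'), ?_, ?_, by rw [d_sub, d_d, sub_zero]⟩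
  · rw [act_sub, act_d, htE, act_divide_eq ρ hst.symm het htE']
  · rw [← sub_eq_zero, act_sub, act_d, sub_sub_sub_comm, ← d_sub, act_divide_sub ρ hes, hE',
      sub_self]

/-- Averaging over an involution that inverts `s` and `t`. -/
theorem exists_d_eq_of_involution [Invertible (2 : k)] {s t σ : G} (hst : Commute s t)
    (hσ : σ * σ = 1) (hσt : t * σ = σ * t⁻¹) (hσs : s * σ = σ * s⁻¹) {c e : G → ℤ}
    (hct : ∀ x, c (t * x) = c x + 1) (hes : ∀ x, e (s * x) = e x + 1)
    (het : ∀ x, e (t * x) = e x)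
    (F : HomogCochain G W (m + 4)) (hF : d F = 0) (ht : act ρ t F = F) (hs : act ρ s F = F)
    (hσF : act ρ σ F = F) :
    ∃ E : HomogCochain G W (m + 3),
      act ρ t E = E ∧ act ρ s E = E ∧ act ρ σ E = E ∧ d E = F := by
  obtain ⟨E, htE, hsE, rfl⟩ := exists_d_eq_of_act_eq_of_act_eq ρ hst hct hes het F hF ht hs
  have ht' : act ρ t⁻¹ E = E := (fixer ρ E).inv_mem htE
  have hs' : act ρ s⁻¹ E = E := (fixer ρ E).inv_mem hsE
  -- Since `σ` inverts `t` and `s`, the translate `σ E` is again invariant under both.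
  refine ⟨⅟(2 : k) • (E + act ρ σ E), ?_, ?_, ?_, ?_⟩
  · rw [act_smul, act_add, ← act_mul, hσt, act_mul, ht', htE]
  · rw [act_smul, act_add, ← act_mul, hσs, act_mul, hs', hsE]
  · rw [act_smul, act_add, ← act_mul, hσ, act_one, add_comm E]
  · rw [d_smul, d_add, ← act_d, hσF, ← two_smul k, smul_smul, invOf_mul_self, one_smul]

end vanishing

end HomogCochain

/-! ### Hochschild cochains of a group algebra as invariant homogeneous cochains. -/

namespace Hochschild

open MulOpposite

set_option linter.unusedSectionVars false

section extension

theorem exists_multilinearMap_of_basis {k A W ι : Type*} [CommRing k] [AddCommGroup A] [Module k A]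
    [AddCommGroup W] [Module k W] (b : Module.Basis ι k A) {n : ℕ} (φ : (Fin n → ι) → W) :
    ∃ e : MultilinearMap k (fun _ : Fin n => A) W, ∀ v, e (fun i => b (v i)) = φ v := by
  refine ⟨((Basis.piTensorProduct fun _ : Fin n => b).constr k φ).compMultilinearMap
    (PiTensorProduct.tprod k), fun v => ?_⟩
  rw [LinearMap.compMultilinearMap_apply,
    ← Basis.piTensorProduct_apply (fun _ : Fin n => b) v, Module.Basis.constr_basis]

end extension

variable {k G W : Type*} [CommRing k] [Group G] [AddCommGroup W] [Module k W]
  [Module (MonoidAlgebra k G) W] [Module (MonoidAlgebra k G)ᵐᵒᵖ W]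
  [IsScalarTower k (MonoidAlgebra k G) W] [IsScalarTower k (MonoidAlgebra k G)ᵐᵒᵖ W]
  [SMulCommClass (MonoidAlgebra k G) (MonoidAlgebra k G)ᵐᵒᵖ W]

variable (k G W) in
/-- The conjugation action `g • w = g w g⁻¹` of `G` on a `k G`-bimodule. -/
noncomputable def conjRep : Representation k G W where
  toFun g :=
    { toFun := fun w => MonoidAlgebra.of k G g • op (MonoidAlgebra.of k G g⁻¹) • w
      map_add' := by simp
      map_smul' := fun c w => by
        rw [RingHom.id_apply, smul_comm _ c w, smul_comm _ c] }
  map_one' := by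
    ext w
    simp [-MonoidAlgebra.of_apply]
  map_mul' g h := by
    ext w
    simp only [LinearMap.coe_mk, AddHom.coe_mk, Module.End.mul_apply, mul_inv_rev, map_mul, op_mul,
      mul_smul]
    rw [smul_comm (MonoidAlgebra.of k G h) (op (MonoidAlgebra.of k G g⁻¹))]

theorem conjRep_apply (g : G) (w : W) :
    conjRep k G W g w = MonoidAlgebra.of k G g • op (MonoidAlgebra.of k G g⁻¹) • w := rfl

/-- The homogeneous cochain `x₀ f(x₀⁻¹x₁, …, xₙ₋₁⁻¹xₙ) xₙ⁻¹` of a Hochschild cochain `f`. -/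
noncomputable def toHomog {n : ℕ} (f : Cochain k (MonoidAlgebra k G) W n) : HomogCochain G W (n + 1) :=
  fun x => MonoidAlgebra.of k G (x 0) • op (MonoidAlgebra.of k G (x (Fin.last n))⁻¹) •
    f fun i => MonoidAlgebra.of k G ((x i.castSucc)⁻¹ * x i.succ)

theorem toHomog_injective {n : ℕ} :
    Function.Injective (toHomog : Cochain k (MonoidAlgebra k G) W n → HomogCochain G W (n + 1)) := by
  intro f f' h
  refine Module.Basis.ext_multilinear (fun _ => MonoidAlgebra.basis G k) fun v => ?_
  -- At the tuple of partial products `1, v₀, v₀v₁, …` the consecutive quotients are the `vᵢ`; right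
  -- multiplication by the last product then isolates `f v`.
  have hv := congrArg (fun w => op (MonoidAlgebra.of k G (Fin.partialProd v (Fin.last n))) • w)
    (congrFun h (Fin.partialProd v))
  simp only [toHomog, Fin.partialProd_right_inv, Fin.partialProd_zero, map_one, one_smul,
    ← mul_smul, ← op_mul, ← map_mul, inv_mul_cancel, op_one] at hv
  simpa [MonoidAlgebra.basis] using hv

theorem act_toHomog {n : ℕ} (f : Cochain k (MonoidAlgebra k G) W n) (g : G) :
    HomogCochain.act (conjRep k G W) g (toHomog f) = toHomog f := by
  ext x
  simp only [HomogCochain.act, toHomog, conjRep_apply]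
  rw [← smul_comm (MonoidAlgebra.of k G (g⁻¹ * x 0)) (op (MonoidAlgebra.of k G g⁻¹))]
  simp only [← mul_smul, ← op_mul, ← map_mul]
  simp [mul_assoc]

/-- Invariance reduces `E` to tuples starting at `1`. Such a tuple consists of the partial products
of its consecutive quotients, so the values there prescribe `f` on the group basis. -/
theorem exists_toHomog_eq {n : ℕ} (E : HomogCochain G W (n + 1))
    (hE : ∀ g, HomogCochain.act (conjRep k G W) g E = E) :
    ∃ f : Cochain k (MonoidAlgebra k G) W n, toHomog f = E := by
  obtain ⟨f, hf⟩ := exists_multilinearMap_of_basis (MonoidAlgebra.basis G k)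
    fun v : Fin n → G =>
      op (MonoidAlgebra.of k G (Fin.partialProd v (Fin.last n))) • E (Fin.partialProd v)
  replace hf : ∀ v : Fin n → G, f (fun i => MonoidAlgebra.of k G (v i)) =
      op (MonoidAlgebra.of k G (Fin.partialProd v (Fin.last n))) • E (Fin.partialProd v) := by
    intro v
    rw [← hf]
    simp [MonoidAlgebra.basis]
  refine ⟨f, ?_⟩
  ext x
  have hx : Fin.partialProd (fun i : Fin n => (x i.castSucc)⁻¹ * x i.succ)
      = fun i => (x 0)⁻¹ * x i := by
    conv_rhs => rw [← Fin.partialProd_left_inv x]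
    funext i
    simp
  conv_rhs => rw [← hE (x 0)]
  simp only [toHomog, HomogCochain.act, conjRep_apply, hf, hx]
  simp only [← mul_smul, ← op_mul, ← map_mul]
  simp

theorem dLeft_apply {n : ℕ} (f : Cochain k (MonoidAlgebra k G) W n)
    (g : Fin (n + 1) → MonoidAlgebra k G) : dLeft f g = g 0 • f fun i => g i.succ := rfl

theorem dMid_apply {n : ℕ} (i : Fin n) (f : Cochain k (MonoidAlgebra k G) W n)
    (g : Fin (n + 1) → MonoidAlgebra k G) : dMid i f g = f (contract i g) := rfl

theorem dRight_apply {n : ℕ} (f : Cochain k (MonoidAlgebra k G) W n)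
    (g : Fin (n + 1) → MonoidAlgebra k G) :
    dRight f g = op (g (Fin.last n)) • f fun i => g i.castSucc := rfl

theorem toHomog_dLeft {n : ℕ} (f : Cochain k (MonoidAlgebra k G) W n) (x : Fin (n + 2) → G) :
    toHomog (dLeft f) x = toHomog f fun j => x j.succ := by
  simp only [toHomog, dLeft_apply, Fin.castSucc_zero, Fin.succ_last,
    Fin.castSucc_succ]
  rw [← smul_comm (MonoidAlgebra.of k G _) (op _), ← mul_smul, ← map_mul, mul_inv_cancel_left]

/-- Multiplying two adjacent quotients makes the vertex between them, of index `i + 1`, cancel. -/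
theorem toHomog_dMid {n : ℕ} (i : Fin n) (f : Cochain k (MonoidAlgebra k G) W n)
    (x : Fin (n + 2) → G) :
    toHomog (dMid i f) x = toHomog f fun j => x (i.castSucc.succ.succAbove j) := by
  have h0 : i.castSucc.succ.succAbove 0 = 0 := by simp
  have hl : i.castSucc.succ.succAbove (Fin.last n) = Fin.last (n + 1) := by
    rw [Fin.succAbove_of_le_castSucc _ _ (by simp [Fin.le_def]), Fin.succ_last]
  simp only [toHomog, dMid_apply, h0, hl]
  congr 3
  funext j
  simp only [contract, ← map_mul]
  split_ifs with h₁ h₂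
  · rw [Fin.lt_def] at h₁
    rw [Fin.succAbove_of_castSucc_lt _ _ (Fin.lt_def.2 (by simp only [Fin.val_castSucc, Fin.val_succ]; omega)),
      Fin.succAbove_of_castSucc_lt _ _ (Fin.lt_def.2 (by simp only [Fin.val_castSucc, Fin.val_succ]; omega)), Fin.castSucc_succ]
  · subst h₂
    rw [Fin.succAbove_of_castSucc_lt _ _ (by simp [Fin.lt_def]),
      Fin.succAbove_of_le_castSucc _ _ (by simp), Fin.castSucc_succ, mul_assoc,
      mul_inv_cancel_left]
  · have h₃ : (i : ℕ) < j := by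
      rw [Fin.lt_def] at h₁
      rw [Fin.ext_iff] at h₂
      omega
    rw [Fin.succAbove_of_le_castSucc _ _ (Fin.le_def.2 (by simp only [Fin.val_castSucc, Fin.val_succ]; omega)),
      Fin.succAbove_of_le_castSucc _ _ (Fin.le_def.2 (by simp only [Fin.val_castSucc, Fin.val_succ]; omega)), Fin.castSucc_succ]

theorem toHomog_dRight {n : ℕ} (f : Cochain k (MonoidAlgebra k G) W n) (x : Fin (n + 2) → G) :
    toHomog (dRight f) x = toHomog f fun j => x j.castSucc := by
  simp only [toHomog, dRight_apply, Fin.castSucc_zero, Fin.succ_last,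
    Fin.castSucc_succ]
  rw [← mul_smul (op _) (op _), ← op_mul, ← map_mul, mul_assoc, mul_inv_cancel, mul_one]

theorem toHomog_differential {n : ℕ} (f : Cochain k (MonoidAlgebra k G) W n) :
    toHomog (differential k (MonoidAlgebra k G) W n f) = HomogCochain.d (toHomog f) := by
  ext x
  have hadd : ∀ f f' : Cochain k (MonoidAlgebra k G) W (n + 1),
      toHomog (f + f') x = toHomog f x + toHomog f' x := fun f f' => by simp [toHomog]
  have hsmul : ∀ (c : k) (f : Cochain k (MonoidAlgebra k G) W (n + 1)),
      toHomog (c • f) x = c • toHomog f x := fun c f => by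
    simp only [toHomog, smul_apply]
    rw [smul_comm _ c, smul_comm _ c]
  have hsum : ∀ f : Fin n → Cochain k (MonoidAlgebra k G) W (n + 1),
      toHomog (∑ i, f i) x = ∑ i, toHomog (f i) x := fun f => by
    simp [toHomog, Finset.smul_sum]
  -- The Hochschild signs lie in `k`, the simplicial ones in `ℤ`.
  have hsign : ∀ (l : ℕ) (w : W), (-1 : k) ^ l • w = (-1 : ℤ) ^ l • w := fun l w => by
    rcases neg_one_pow_eq_or k l with h | h <;> rcases Nat.even_or_odd l with h' | h' <;>
      simp [h'.neg_one_pow]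
  simp only [HomogCochain.d]
  rw [Fin.sum_univ_succ, Fin.sum_univ_castSucc, ← add_assoc]
  change toHomog (dLeft f + ∑ i : Fin n, (-1 : k) ^ ((i : ℕ) + 1) • dMid i f
    + (-1 : k) ^ (n + 1) • dRight f) x = _
  simp only [hadd, hsum, hsmul, hsign, toHomog_dLeft, toHomog_dMid, toHomog_dRight]
  simp

/-- If every homogeneous cocycle invariant under conjugation is the coboundary of an invariant
cochain, then the Hochschild cohomology of the group algebra vanishes. -/
theorem subsingleton_cohomology {n : ℕ}
    (h : ∀ F : HomogCochain G W (n + 2), HomogCochain.d F = 0 →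
      (∀ g, HomogCochain.act (conjRep k G W) g F = F) →
      ∃ E : HomogCochain G W (n + 1),
        (∀ g, HomogCochain.act (conjRep k G W) g E = E) ∧ HomogCochain.d E = F) :
    Subsingleton (Cohomology k (MonoidAlgebra k G) W (n + 1)) := by
  rw [Submodule.Quotient.subsingleton_iff, Submodule.submoduleOf_eq_top]
  intro f hf
  have hd : HomogCochain.d (toHomog f) = 0 := by
    rw [← toHomog_differential, LinearMap.mem_ker.1 hf]
    ext x
    simp [toHomog]
  obtain ⟨E, hE, hdE⟩ := h (toHomog f) hd (act_toHomog f)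
  obtain ⟨e, rfl⟩ := exists_toHomog_eq E hE
  exact ⟨e, toHomog_injective (by rw [toHomog_differential, hdE])⟩

end Hochschild

/-! ### The translations and half-turns in `G^2_3`. -/

namespace G23

open G23Gen

/-- The half-turns of `ℤ²` by which the generators of `G^2_3` act. -/
def halfTurn : G23Gen → Equiv.Perm (ℤ × ℤ)
  | .a => Function.Involutive.toPerm (fun p => (-p.1 - 1, -p.2)) fun p => by ext <;> simp
  | .b => Function.Involutive.toPerm (fun p => (-p.1, -p.2 - 1)) fun p => by ext <;> simp
  | .c => Function.Involutive.toPerm (fun p => (-p.1, -p.2)) fun p => by ext <;> simp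

theorem halfTurn_a (p : ℤ × ℤ) : halfTurn a p = (-p.1 - 1, -p.2) := rfl

theorem halfTurn_b (p : ℤ × ℤ) : halfTurn b p = (-p.1, -p.2 - 1) := rfl

theorem halfTurn_c (p : ℤ × ℤ) : halfTurn c p = (-p.1, -p.2) := rfl

/-- The action of `G^2_3` on `ℤ²` by translations and half-turns. -/
def toPerm : G23 →* Equiv.Perm (ℤ × ℤ) :=
  PresentedGroup.toGroup (f := halfTurn) (by
    rintro r (rfl | rfl | rfl | rfl)
    · ext p <;> simp [halfTurn_a, pow_two]
    · ext p <;> simp [halfTurn_b, pow_two]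
    · ext p <;> simp [halfTurn_c, pow_two]
    · rw [map_mul, map_inv, mul_inv_eq_one]
      ext p <;> simp [halfTurn_a, halfTurn_b, halfTurn_c] <;> ring)

/-- The generators of `G^2_3`. -/
abbrev gen (x : G23Gen) : G23 := PresentedGroup.of x

theorem toPerm_gen (x : G23Gen) : toPerm (gen x) = halfTurn x :=
  PresentedGroup.toGroup.of _

theorem gen_mul_self (x : G23Gen) : gen x * gen x = 1 := by
  rw [← pow_two]
  refine PresentedGroup.one_of_mem (rels := G23Rels) (x := FreeGroup.of x ^ 2) ?_
  cases x <;> simp [G23Rels]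

theorem gen_inv (x : G23Gen) : (gen x)⁻¹ = gen x :=
  inv_eq_of_mul_eq_one_left (gen_mul_self x)

theorem gen_relation : gen b * gen c * gen a = gen a * gen c * gen b := by
  refine PresentedGroup.mk_eq_mk_of_mul_inv_mem (rels := G23Rels)
    (x := FreeGroup.of b * FreeGroup.of c * FreeGroup.of a)
    (y := FreeGroup.of a * FreeGroup.of c * FreeGroup.of b) ?_
  simp [G23Rels]

/-- This is the relation `bca = acb` multiplied on the left by `c`. -/
theorem commute_translations : Commute (gen c * gen b) (gen c * gen a) := by
  have h := congrArg (gen c * ·) gen_relation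
  simpa [Commute, SemiconjBy, mul_assoc] using h

theorem translation_mul_half_turn (x : G23Gen) :
    gen c * gen x * gen c = gen c * (gen c * gen x)⁻¹ := by
  rw [mul_inv_rev, gen_inv, gen_inv, mul_assoc]

/-- Applied to the subgroup fixing a cochain, it reduces full invariance to invariance under `ca`,
`cb` and `c`. -/
theorem mem_of_translations_mem (H : Subgroup G23) (ha : gen c * gen a ∈ H)
    (hb : gen c * gen b ∈ H) (hc : gen c ∈ H) (g : G23) : g ∈ H := by
  have hle : Subgroup.closure (Set.range (PresentedGroup.of : G23Gen → G23)) ≤ H := by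
    rw [Subgroup.closure_le]
    rintro _ ⟨x, rfl⟩
    cases x
    · exact (H.mul_mem_cancel_left hc).1 ha
    · exact (H.mul_mem_cancel_left hc).1 hb
    · exact hc
  rw [PresentedGroup.closure_range_of] at hle
  exact hle (Subgroup.mem_top g)

theorem toPerm_translation_a (x : G23) (p : ℤ × ℤ) :
    toPerm (gen c * gen a * x) p = ((toPerm x p).1 + 1, (toPerm x p).2) := by
  simp only [map_mul, toPerm_gen, Equiv.Perm.mul_apply, halfTurn_a, halfTurn_c]
  ext <;> simp [add_comm]

theorem toPerm_translation_b (x : G23) (p : ℤ × ℤ) :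
    toPerm (gen c * gen b * x) p = ((toPerm x p).1, (toPerm x p).2 + 1) := by
  simp only [map_mul, toPerm_gen, Equiv.Perm.mul_apply, halfTurn_b, halfTurn_c]
  ext <;> simp [add_comm]

/-- `Hⁿ(G^2_3, W) = 0` for `n ≥ 3` when `2` is invertible. -/
theorem exists_invariant_d_eq {k W : Type*} [CommRing k] [Invertible (2 : k)] [AddCommGroup W]
    [Module k W] (ρ : Representation k G23 W) {m : ℕ} (F : HomogCochain G23 W (m + 4))
    (hF : HomogCochain.d F = 0) (hinv : ∀ g, HomogCochain.act ρ g F = F) :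
    ∃ E : HomogCochain G23 W (m + 3),
      (∀ g, HomogCochain.act ρ g E = E) ∧ HomogCochain.d E = F := by
  obtain ⟨E, hta, htb, hc, hE⟩ := HomogCochain.exists_d_eq_of_involution ρ
    (s := gen c * gen b) (t := gen c * gen a) (σ := gen c)
    -- The integer coordinates of a group element are those of its image of the origin. Only this
    -- action is needed, not an explicit semidirect product decomposition.
    (c := fun x => (toPerm x 0).1) (e := fun x => (toPerm x 0).2)
    commute_translations (gen_mul_self c) (translation_mul_half_turn a)
    (translation_mul_half_turn b) (fun x => by rw [toPerm_translation_a])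
    (fun x => by rw [toPerm_translation_b]) (fun x => by rw [toPerm_translation_a])
    F hF (hinv _) (hinv _) (hinv _)
  exact ⟨E, mem_of_translations_mem (HomogCochain.fixer ρ E) hta htb hc, hE⟩

end G23

/-- Let `k` be a field of characteristic different from `2` and `W` a `k G^2_3`-bimodule (the left
and right actions commute and both are compatible with the `k`-vector space structure)
of dimension `1` over `k`. Then `Hⁿ(k G^2_3, W) = 0` for all `n ≥ 3`. -/
theorem mainTheorem2 {k : Type*} [Field k] (hk : ringChar k ≠ 2)
    {W : Type*} [AddCommGroup W] [Module k W]
    [Module (MonoidAlgebra k G23) W] [Module (MonoidAlgebra k G23)ᵐᵒᵖ W]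
    [IsScalarTower k (MonoidAlgebra k G23) W]
    [IsScalarTower k (MonoidAlgebra k G23)ᵐᵒᵖ W]
    [SMulCommClass (MonoidAlgebra k G23) (MonoidAlgebra k G23)ᵐᵒᵖ W]
    (hW : Module.finrank k W = 1) (n : ℕ) (hn : 3 ≤ n) :
    Subsingleton (Hochschild.Cohomology k (MonoidAlgebra k G23) W n) := by
  obtain ⟨m, rfl⟩ := Nat.exists_eq_add_of_le' hn
  have : Invertible (2 : k) := invertibleOfNonzero (Ring.two_ne_zero hk)
  -- Degree `m + 3` corresponds to homogeneous cochains in `m + 4` variables.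
  exact Hochschild.subsingleton_cohomology fun F hF hinv =>
    G23.exists_invariant_d_eq (Hochschild.conjRep k G23 W) F hF hinv
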